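/- For a graph $G$ let $k_t(G)$ be the number of $t$-vertex cliques of $G$, let $T(n,r)$ be the $r$-partite Turán graph on $n$ vertices (the complete $r$-partite graph on $n$ vertices whose part sizes differ pairwise by at most one), and let $K_{s}(b)$ be the complete $s$-partite graph with all parts of size $b$, i.e. the blowup of $K_s$ in which every vertex is replaced by an independent set of size $b$ and every edge by a complete bipartite graph. For every integer $r\ge 1$ and every real $\varepsilon>0$ there are a real $C=C(\varepsilon,r)>0$ and an integer $n_0=n_0(\varepsilon,r)$ such that the following holds for every integer $t$ with $1\le t\le r$: if $G$ is a graph on $n\ge n_0$ vertices and $$k_t(G)\ \ge\ (1+\varepsilon)\,k_t(T(n,r)),$$ then $G$ contains $K_{r+1}(b)$ as a (not necessarily induced) subgraph for some integer $b\ge C\log n$. -/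

import Mathlib

/-!
The proof combines supersaturation with Nikiforov's theorem on graphs with many cliques. Write `k_s`
for the number of `s`-cliques.

*Supersaturation.* Counting the common neighbours of `s`-cliques gives
`(s + 1) k_{s+1} ≥ k_s (n - s (n / r + 1))` for the Turán graph. If `G` has `1 + ε` times as many
`t`-cliques as the Turán graph, then comparing the ratios `k_{s+1} / k_s` for `s < t` shows that one
of them is larger by a constant factor in `G`
(`SimpleGraph.exists_lt_mul_card_cliqueFinset_succ`), that is,
`(s + 1) k_{s+1} ≥ k_s n (1 - s θ)` for some `s < t` and some fixed `θ < 1 / r`. The Moon–Moser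
inequality (`SimpleGraph.moon_moser`) propagates this bound, with the same `θ`, to all larger `s`
(`SimpleGraph.mul_card_cliqueFinset_le_succ`). Since `1 - s θ` stays bounded away from `0` for
`s ≤ r`, it follows that `k_{r+1} ≥ c n ^ (r + 1)`
(`SimpleGraph.exists_mul_pow_le_card_cliqueFinset`).

*Blow-ups.* A dense set `H` of ordered `k`-cliques yields `b = Ω(log n)` members of `H` such that
vertices in different positions, of the same or of different members, are always adjacent, and
vertices in the same position of different members are distinct
(`SimpleGraph.exists_multipartite_of_dense_cliques`). This goes by induction on `k`. The
`(k - 1)`-tuples with at least `c n / 2` extensions to a member of `H` are themselves dense, so the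
induction hypothesis gives `b` of them. There are only `2 ^ b` subsets of these, and `2 ^ b` is a
small power of `n`, so by pigeonhole some `Ω(b)` of them are all extended by the same `Ω(b)`
vertices, and these vertices form the new part.
-/

namespace SimpleGraph

open Finset

/-! ### Double counting cliques -/

section CliqueCounting

variable {V : Type*} [Fintype V] [DecidableEq V] (G : SimpleGraph V) [DecidableRel G.Adj]

/-- The vertices adjacent to every vertex of `B`. When `B` is a clique, these are the vertices
that extend `B` to a clique with one more vertex. -/
def commonNeighborFinset (B : Finset V) : Finset V := {w | ∀ b ∈ B, G.Adj w b}

variable {G} in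
lemma mem_commonNeighborFinset {B : Finset V} {w : V} :
    w ∈ G.commonNeighborFinset B ↔ ∀ b ∈ B, G.Adj w b := by
  simp [commonNeighborFinset]

/-- Double counting of the pairs consisting of an `(s + 1)`-clique and one of its vertices:
removing the vertex leaves an `s`-clique together with one of its common neighbours. -/
lemma sum_cliqueFinset_succ_sum_erase (s : ℕ) (f : Finset V → ℝ) :
    ∑ A ∈ G.cliqueFinset (s + 1), ∑ v ∈ A, f (A.erase v) =
      ∑ B ∈ G.cliqueFinset s, (#(G.commonNeighborFinset B) : ℝ) * f B := by
  simp_rw [← nsmul_eq_mul, ← sum_const]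
  rw [sum_sigma', sum_sigma']
  refine sum_bij' (fun p _ => ⟨p.1.erase p.2, p.2⟩) (fun p _ => ⟨insert p.2 p.1, p.2⟩)
    ?_ ?_ ?_ ?_ ?_
  · rintro ⟨A, v⟩ h
    simp only [mem_sigma, mem_cliqueFinset_iff, mem_commonNeighborFinset] at h ⊢
    refine ⟨by simpa using h.1.erase_of_mem h.2, fun b hb => ?_⟩
    exact h.1.isClique h.2 (mem_of_mem_erase hb) (ne_of_mem_erase hb).symm
  · rintro ⟨B, w⟩ h
    simp only [mem_sigma, mem_cliqueFinset_iff, mem_commonNeighborFinset] at h ⊢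
    exact ⟨h.1.insert h.2, mem_insert_self _ _⟩
  · rintro ⟨A, v⟩ h
    simp only [mem_sigma] at h
    simp [insert_erase h.2]
  · rintro ⟨B, w⟩ h
    simp only [mem_sigma, mem_commonNeighborFinset] at h
    have : w ∉ B := fun hw => G.irrefl (h.2 w hw)
    simp [erase_insert this]
  · intro p _
    rfl

lemma sum_card_commonNeighborFinset (s : ℕ) :
    ∑ B ∈ G.cliqueFinset s, (#(G.commonNeighborFinset B) : ℝ) =
      (s + 1) * #(G.cliqueFinset (s + 1)) := by
  have h := G.sum_cliqueFinset_succ_sum_erase s (fun _ => 1)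
  simp only [mul_one] at h
  rw [← h]
  have : ∀ A ∈ G.cliqueFinset (s + 1), ∑ v ∈ A, (1 : ℝ) = s + 1 := by
    intro A hA
    rw [mem_cliqueFinset_iff] at hA
    simp [hA.card_eq]
  rw [sum_congr rfl this, sum_const, nsmul_eq_mul, mul_comm]

/-- A vertex outside the common neighbourhood of `A` is a common neighbour of at most one of the
sets `A \ {v}`, since any two of these sets cover `A`. -/
lemma sum_card_commonNeighborFinset_erase_le {s : ℕ} {A : Finset V} (hA : #A = s + 1) :
    ∑ v ∈ A, (#(G.commonNeighborFinset (A.erase v)) : ℝ) ≤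
      Fintype.card V + s * #(G.commonNeighborFinset A) := by
  have key : ∑ v ∈ A, #(G.commonNeighborFinset (A.erase v)) ≤
      Fintype.card V + s * #(G.commonNeighborFinset A) := by
    calc ∑ v ∈ A, #(G.commonNeighborFinset (A.erase v))
        = ∑ w : V, #{v ∈ A | w ∈ G.commonNeighborFinset (A.erase v)} := by
          simp_rw [card_eq_sum_ones, sum_filter]
          rw [sum_comm]
          refine sum_congr rfl fun v _ => ?_
          rw [← sum_filter]
          congr 1
          ext; simp
      _ ≤ ∑ w : V, (1 + if w ∈ G.commonNeighborFinset A then s else 0) := by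
          refine sum_le_sum fun w _ => ?_
          split_ifs with hw
          · exact (card_filter_le _ _).trans (by omega)
          · rw [add_zero, card_le_one]
            intro a ha b hb
            by_contra hab
            simp only [mem_filter, mem_commonNeighborFinset, mem_erase] at ha hb hw
            refine hw fun x hx => ?_
            by_cases hxa : x = a
            · exact hb.2 x ⟨fun h => hab (hxa ▸ h), hx⟩
            · exact ha.2 x ⟨hxa, hx⟩
      _ = _ := by
          rw [sum_add_distrib, ← sum_filter]
          simp [mul_comm]
  exact_mod_cast key

/-- The **Moon–Moser inequality** between the numbers of cliques of three consecutive sizes. -/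
lemma moon_moser (s : ℕ) :
    ((s + 1) * #(G.cliqueFinset (s + 1)) : ℝ) ^ 2 ≤
      #(G.cliqueFinset s) * (Fintype.card V * #(G.cliqueFinset (s + 1)) +
        s * ((s + 2) * #(G.cliqueFinset (s + 2)))) := by
  rw [← sum_card_commonNeighborFinset]
  refine sq_sum_le_card_mul_sum_sq.trans ?_
  gcongr
  simp_rw [sq]
  rw [← G.sum_cliqueFinset_succ_sum_erase s fun B => (#(G.commonNeighborFinset B) : ℝ)]
  have h2 := G.sum_card_commonNeighborFinset (s + 1)
  push_cast at h2
  rw [show (s : ℝ) + 1 + 1 = s + 2 by ring] at h2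
  rw [← h2, mul_sum]
  calc _ ≤ ∑ A ∈ G.cliqueFinset (s + 1),
        (Fintype.card V + s * #(G.commonNeighborFinset A) : ℝ) := by
        refine sum_le_sum fun A hA => ?_
        rw [mem_cliqueFinset_iff] at hA
        exact G.sum_card_commonNeighborFinset_erase_le hA.card_eq
    _ = _ := by rw [sum_add_distrib, sum_const, nsmul_eq_mul, mul_comm]

lemma card_cliqueFinset_zero : #(G.cliqueFinset 0) = 1 := by
  rw [card_eq_one]
  exact ⟨∅, by ext; simp [mem_cliqueFinset_iff, isNClique_zero]⟩

/-- One step of the Moon–Moser inequality: if `G` has at least as many `(s + 1)`-cliques per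
`s`-clique as a complete multipartite graph with parts of proportion `θ`, then the same holds
one size up. -/
lemma mul_card_cliqueFinset_le_succ [Nonempty V] {s : ℕ} {θ : ℝ} (hs : 1 ≤ s) (hθ : s * θ < 1)
    (hk : 0 < #(G.cliqueFinset s))
    (h : #(G.cliqueFinset s) * (Fintype.card V * (1 - s * θ)) ≤
      ((s + 1) * #(G.cliqueFinset (s + 1)) : ℝ)) :
    0 < #(G.cliqueFinset (s + 1)) ∧
      #(G.cliqueFinset (s + 1)) * (Fintype.card V * (1 - (s + 1 : ℕ) * θ)) ≤
        (((s + 1 : ℕ) + 1) * #(G.cliqueFinset (s + 2)) : ℝ) := by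
  have hn : (0 : ℝ) < Fintype.card V := by exact_mod_cast Fintype.card_pos
  have hk' : (0 : ℝ) < #(G.cliqueFinset s) := by exact_mod_cast hk
  have hs' : (0 : ℝ) < s := by exact_mod_cast hs
  have hx : (0 : ℝ) < #(G.cliqueFinset (s + 1)) := by
    have : 0 < #(G.cliqueFinset s) * (Fintype.card V * (1 - s * θ)) :=
      mul_pos hk' (mul_pos hn (by linarith))
    exact pos_of_mul_pos_right (this.trans_le h) (by positivity)
  refine ⟨by exact_mod_cast hx, ?_⟩
  have mm := G.moon_moser s
  set a : ℝ := ((#(G.cliqueFinset s) : ℕ) : ℝ)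
  set x : ℝ := ((#(G.cliqueFinset (s + 1)) : ℕ) : ℝ)
  set y : ℝ := ((#(G.cliqueFinset (s + 2)) : ℕ) : ℝ)
  set n : ℝ := ((Fintype.card V : ℕ) : ℝ)
  have h1 : a * ((s + 1) * x * (n * (1 - s * θ))) ≤ a * (n * x + s * ((s + 2) * y)) := by
    refine le_trans ?_ mm
    calc a * ((s + 1) * x * (n * (1 - s * θ))) = (s + 1) * x * (a * (n * (1 - s * θ))) := by ring
      _ ≤ (s + 1) * x * ((s + 1) * x) := by gcongr
      _ = _ := by ring
  have h2 := le_of_mul_le_mul_left h1 hk'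
  refine le_of_mul_le_mul_left (a := (s : ℝ)) ?_ hs'
  push_cast
  linarith

end CliqueCounting

/-! ### Supersaturation -/

lemma card_filter_mod_eq_le {n r : ℕ} (hr : 0 < r) (a : ℕ) :
    #{w : Fin n | (w : ℕ) % r = a % r} ≤ n / r + 1 := by
  calc #{w : Fin n | (w : ℕ) % r = a % r} ≤ #{w ∈ range n | w ≡ a [MOD r]} := by
        refine card_le_card_of_injOn (fun w => (w : ℕ)) ?_ (fun _ _ _ _ h => Fin.ext h)
        intro w hw
        rw [mem_coe, mem_filter] at hw
        exact mem_coe.2 (mem_filter.2 ⟨mem_range.2 w.2, hw.2⟩)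
    _ = n / r + if a % r < n % r then 1 else 0 := by
        rw [← Nat.count_eq_card_filter_range, Nat.count_modEq_card n hr]
    _ ≤ n / r + 1 := by split_ifs <;> omega

lemma le_card_commonNeighborFinset_turanGraph {n r : ℕ} (hr : 0 < r) (B : Finset (Fin n)) :
    (n : ℝ) - #B * (n / r + 1) ≤ #((turanGraph n r).commonNeighborFinset B) := by
  have hcover : (univ : Finset (Fin n)) ⊆ (turanGraph n r).commonNeighborFinset B ∪
      B.biUnion fun b => {w : Fin n | (w : ℕ) % r = (b : ℕ) % r} := by
    intro w _
    rw [mem_union, mem_commonNeighborFinset]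
    by_contra! h
    obtain ⟨⟨b, hb, hwb⟩, h2⟩ := h
    rw [turanGraph_adj, not_not] at hwb
    exact h2 (mem_biUnion.2 ⟨b, hb, by simpa using hwb⟩)
  have h := (card_le_card hcover).trans (card_union_le _ _)
  have h2 : #(B.biUnion fun b => {w : Fin n | (w : ℕ) % r = (b : ℕ) % r}) ≤ #B * (n / r + 1) :=
    card_biUnion_le_card_mul _ _ _ fun b _ => card_filter_mod_eq_le hr b
  rw [card_univ, Fintype.card_fin] at h
  have h3 : (n : ℝ) ≤ #((turanGraph n r).commonNeighborFinset B) + #B * ((n / r : ℕ) + 1) := by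
    exact_mod_cast h.trans (Nat.add_le_add_left h2 _)
  have h4 : ((n / r : ℕ) : ℝ) ≤ n / r := Nat.cast_div_le
  have h5 : (#B : ℝ) * ((n / r : ℕ) + 1) ≤ #B * (n / r + 1) := by gcongr
  linarith

lemma card_cliqueFinset_turanGraph_mul_le {n r : ℕ} (hr : 0 < r) (s : ℕ) :
    (#((turanGraph n r).cliqueFinset s) * (n - s * (n / r + 1)) : ℝ) ≤
      (s + 1) * #((turanGraph n r).cliqueFinset (s + 1)) := by
  rw [← sum_card_commonNeighborFinset, ← nsmul_eq_mul, ← sum_const]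
  refine sum_le_sum fun B hB => ?_
  rw [mem_cliqueFinset_iff] at hB
  simpa [hB.card_eq] using le_card_commonNeighborFinset_turanGraph hr B

lemma succ_mul_card_cliqueFinset_succ_le {V : Type*} [Fintype V] [DecidableEq V]
    (G : SimpleGraph V) [DecidableRel G.Adj] (s : ℕ) :
    ((s + 1) * #(G.cliqueFinset (s + 1)) : ℝ) ≤ #(G.cliqueFinset s) * Fintype.card V := by
  rw [← sum_card_commonNeighborFinset, ← nsmul_eq_mul, ← sum_const]
  refine sum_le_sum fun B _ => ?_
  exact_mod_cast card_le_univ _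

/-- If `G` has many more `t`-cliques than the Turán graph, then for some `s < t` its number of
`(s + 1)`-cliques per `s`-clique exceeds by a constant factor what the Turán graph guarantees. -/
lemma exists_lt_mul_card_cliqueFinset_succ {n r t : ℕ} (hr : 0 < r) {η : ℝ} (hη : 0 < η)
    (G : SimpleGraph (Fin n)) [DecidableRel G.Adj]
    (hn : ∀ s < t, 0 < (n - s * (n / r + 1) : ℝ))
    (h : (1 + η) ^ t * #((turanGraph n r).cliqueFinset t) < (#(G.cliqueFinset t) : ℝ)) :
    ∃ s, 1 ≤ s ∧ s < t ∧ 0 < #(G.cliqueFinset s) ∧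
      #(G.cliqueFinset s) * ((1 + η) * (n - s * (n / r + 1))) <
        ((s + 1) * #(G.cliqueFinset (s + 1)) : ℝ) := by
  obtain ⟨s, hst, hs⟩ : ∃ s < t, #(G.cliqueFinset s) * ((1 + η) * (n - s * (n / r + 1))) <
      ((s + 1) * #(G.cliqueFinset (s + 1)) : ℝ) := by
    by_contra! hcon
    have key : ∀ s ≤ t, (#(G.cliqueFinset s) : ℝ) ≤
        (1 + η) ^ s * #((turanGraph n r).cliqueFinset s) := by
      intro s
      induction s with
      | zero => intro _; simp [card_cliqueFinset_zero]
      | succ s ih =>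
        intro hs
        have hpos := hn s hs
        have hT := card_cliqueFinset_turanGraph_mul_le (n := n) hr s
        refine le_of_mul_le_mul_left (a := (s + 1 : ℝ)) ?_ (by positivity)
        calc ((s + 1) * #(G.cliqueFinset (s + 1)) : ℝ)
            ≤ #(G.cliqueFinset s) * ((1 + η) * (n - s * (n / r + 1))) := hcon s hs
          _ ≤ (1 + η) ^ s * #((turanGraph n r).cliqueFinset s) *
                ((1 + η) * (n - s * (n / r + 1))) := by
              gcongr
              exact ih (by omega)
          _ = (1 + η) ^ (s + 1) *
                (#((turanGraph n r).cliqueFinset s) * (n - s * (n / r + 1))) := by ring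
          _ ≤ (1 + η) ^ (s + 1) * ((s + 1) * #((turanGraph n r).cliqueFinset (s + 1))) := by
              gcongr
          _ = _ := by ring
    exact absurd h (not_lt.2 (key t le_rfl))
  have hpos := hn s hst
  have hup := G.succ_mul_card_cliqueFinset_succ_le s
  rw [Fintype.card_fin] at hup
  refine ⟨s, ?_, hst, ?_, hs⟩
  · rcases Nat.eq_zero_or_pos s with rfl | h0
    · simp [card_cliqueFinset_zero] at hs hup hpos
      have h1 : (#(G.cliqueFinset 1) : ℝ) ≤ n := by exact_mod_cast hup
      have h2 : 0 < η * n := mul_pos hη (by exact_mod_cast hpos)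
      linarith
    · exact h0
  · rcases Nat.eq_zero_or_pos #(G.cliqueFinset s) with h0 | h0
    · rw [h0] at hs hup
      simp only [Nat.cast_zero, zero_mul] at hs hup
      linarith
    · exact h0

/-- Supersaturation: a graph with at least `1 + ε` times as many `t`-cliques as the Turán graph
`turanGraph n r`, where `t ≤ r`, has a positive proportion of all possible `(r + 1)`-cliques. -/
theorem exists_mul_pow_le_card_cliqueFinset {r : ℕ} (hr : 0 < r) {ε : ℝ} (hε : 0 < ε) :
    ∃ c : ℝ, 0 < c ∧ c ≤ 1 ∧ ∃ N : ℕ, ∀ t ≤ r, ∀ n, N ≤ n →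
      ∀ (G : SimpleGraph (Fin n)) [DecidableRel G.Adj],
        (1 + ε) * (#((turanGraph n r).cliqueFinset t) : ℝ) ≤ #(G.cliqueFinset t) →
          c * n ^ (r + 1) ≤ #(G.cliqueFinset (r + 1)) := by
  obtain ⟨η, hη, hηε⟩ : ∃ η : ℝ, 0 < η ∧ (1 + η) ^ (r + 1) = 1 + ε := by
    refine ⟨(1 + ε) ^ (((r + 1 : ℕ) : ℝ)⁻¹) - 1, ?_, ?_⟩
    · exact sub_pos.2 (Real.one_lt_rpow (by linarith) (by positivity))
    · rw [add_sub_cancel]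
      exact Real.rpow_inv_natCast_pow (by linarith) (by omega)
  have hr1 : (1 : ℝ) ≤ r := by exact_mod_cast hr
  have hr0 : (0 : ℝ) < r := by linarith
  -- With `s < r` parts removed, the surplus `η (n - s n / r)` is at least `η n / r`. Half of it pays
  -- for the gain `n s γ`, the other half for the rounding error `(1 + η) s`.
  set γ : ℝ := η / (2 * r ^ 2) with hγ
  have hγ0 : 0 < γ := by positivity
  set δ : ℝ := min (1 / (2 * r ^ 2)) (γ / (r + 1)) with hδ
  have hδ0 : 0 < δ := by positivity
  have hδ1 : δ ≤ 1 := (min_le_left _ _).trans (by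
    rw [div_le_one (by positivity)]
    nlinarith)
  obtain ⟨N, hN⟩ := exists_nat_ge (2 * r ^ 2 * ((1 + η) / η) : ℝ)
  refine ⟨δ ^ (r + 1), by positivity, pow_le_one₀ hδ0.le hδ1, N, fun t htr n hn G _ h => ?_⟩
  have hnη : 2 * r ^ 2 * (1 + η) ≤ n * η := by
    have : (2 * r ^ 2 * ((1 + η) / η) : ℝ) ≤ n := hN.trans (by exact_mod_cast hn)
    rwa [← mul_div_assoc, div_le_iff₀ hη] at this
  have hnr : 2 * (r : ℝ) ^ 2 ≤ n := by
    refine le_of_mul_le_mul_right (a := η) ?_ hη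
    nlinarith [sq_nonneg (r : ℝ)]
  have hn0 : (0 : ℝ) < n := by nlinarith
  have : Nonempty (Fin n) := ⟨⟨0, by exact_mod_cast hn0⟩⟩
  -- For `s < r`, the fraction `1 - s / r` of the vertices is at least `1 / r`.
  have hfrac : ∀ s < r, (n : ℝ) / r ≤ n - s * (n / r) := by
    intro s hs
    have h1 : (s : ℝ) + 1 ≤ r := by exact_mod_cast hs
    have h2 : (r : ℝ) * (n / r) = n := by field_simp
    have h3 : ((s : ℝ) + 1) * (n / r) ≤ r * (n / r) := by gcongr
    linarith
  have hgap : ∀ s < r, (n : ℝ) / (2 * r) ≤ n - s * (n / r + 1) := by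
    intro s hs
    have h1 : (s : ℝ) ≤ r := by exact_mod_cast hs.le
    have h2 : (r : ℝ) ≤ n / (2 * r) := by
      rw [le_div_iff₀ (by positivity)]
      linarith
    have h3 : (n : ℝ) / r = n / (2 * r) + n / (2 * r) := by field_simp; norm_num
    linarith [hfrac s hs]
  have hgap0 : ∀ s < r, 0 < (n - s * (n / r + 1) : ℝ) := fun s hs =>
    lt_of_lt_of_le (by positivity) (hgap s hs)
  have hturan : ∀ s ≤ r, (δ * n) ^ s ≤ #((turanGraph n r).cliqueFinset s) := by
    intro s
    induction s with
    | zero => intro _; simp [card_cliqueFinset_zero]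
    | succ s ih =>
      intro hs
      have h1 : (s : ℝ) + 1 ≤ r := by exact_mod_cast hs
      refine le_of_mul_le_mul_left (a := (r : ℝ)) ?_ hr0
      calc (r : ℝ) * (δ * n) ^ (s + 1) = (δ * n) ^ s * (r * (δ * n)) := by ring
        _ ≤ (δ * n) ^ s * (r * (1 / (2 * r ^ 2) * n)) := by
            gcongr
            exact min_le_left _ _
        _ = (δ * n) ^ s * (n / (2 * r)) := by field_simp
        _ ≤ #((turanGraph n r).cliqueFinset s) * (n - s * (n / r + 1)) := by
            gcongr
            · exact ih (by omega)
            · exact hgap s hs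
        _ ≤ (s + 1) * #((turanGraph n r).cliqueFinset (s + 1)) :=
            card_cliqueFinset_turanGraph_mul_le hr s
        _ ≤ r * #((turanGraph n r).cliqueFinset (s + 1)) := by gcongr
  have hTpos : (0 : ℝ) < #((turanGraph n r).cliqueFinset t) :=
    lt_of_lt_of_le (by positivity) (hturan t htr)
  obtain ⟨s₀, hs₀, hs₀t, hpos₀, hrich₀⟩ := exists_lt_mul_card_cliqueFinset_succ (t := t) hr hη G
    (fun s hs => hgap0 s (by omega)) (by
      refine lt_of_lt_of_le ?_ h
      rw [← hηε]
      gcongr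
      · linarith
      · omega)
  -- The surplus factor `1 + η` beats the Turán proportion `1 / r` by `γ`.
  set θ : ℝ := 1 / r - γ with hθ
  have hθs : ∀ s : ℕ, s ≤ r → s * γ ≤ 1 - s * θ := by
    intro s hs
    have : (s : ℝ) * (1 / r) ≤ 1 := by
      rw [mul_one_div, div_le_one hr0]
      exact_mod_cast hs
    rw [hθ]
    linarith
  have hbase : #(G.cliqueFinset s₀) * (n * (1 - s₀ * θ)) ≤
      ((s₀ + 1) * #(G.cliqueFinset (s₀ + 1)) : ℝ) := by
    refine le_trans (mul_le_mul_of_nonneg_left ?_ (Nat.cast_nonneg _)) hrich₀.le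
    have hs₀r : (s₀ : ℝ) ≤ r := by exact_mod_cast (by omega : s₀ ≤ r)
    have h1 := mul_le_mul_of_nonneg_left (hfrac s₀ (by omega)) hη.le
    have h2 : (n : ℝ) * (s₀ * γ) ≤ n * (r * γ) := by gcongr
    have h3 : (1 + η) * s₀ ≤ (1 + η) * r := by gcongr
    have h4 : n * (r * γ) + (1 + η) * r ≤ η * (n / r) := by
      have e1 : n * (r * γ) = n * η / (2 * r) := by rw [hγ]; field_simp
      have e2 : η * (n / r) = n * η / (2 * r) + n * η / (2 * r) := by field_simp; norm_num
      have e3 : (1 + η) * r ≤ n * η / (2 * r) := by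
        rw [le_div_iff₀ (by positivity)]
        linarith
      linarith
    have h5 : (n : ℝ) * (1 - s₀ * θ) = n - s₀ * (n / r) + n * (s₀ * γ) := by
      rw [hθ]; ring
    rw [h5]
    linarith
  have hrich : ∀ s, s₀ ≤ s → s ≤ r → 0 < #(G.cliqueFinset s) ∧
      #(G.cliqueFinset s) * (n * (1 - s * θ)) ≤ ((s + 1) * #(G.cliqueFinset (s + 1)) : ℝ) := by
    intro s hs
    induction s, hs using Nat.le_induction with
    | base => exact fun _ => ⟨hpos₀, hbase⟩
    | succ s hs ih =>
      intro hsr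
      obtain ⟨h1, h2⟩ := ih (by omega)
      have hs1 : (1 : ℝ) ≤ s := by exact_mod_cast hs₀.trans hs
      have h3 : (s : ℝ) * θ < 1 := by
        have := hθs s (by omega)
        nlinarith
      have := G.mul_card_cliqueFinset_le_succ (hs₀.trans hs) h3 h1
        (by rwa [Fintype.card_fin])
      rwa [Fintype.card_fin] at this
  have hfinal : ∀ s, t ≤ s → s ≤ r + 1 → (δ * n) ^ s ≤ #(G.cliqueFinset s) := by
    intro s hs
    induction s, hs using Nat.le_induction with
    | base =>
      intro _
      refine (hturan t htr).trans (le_trans ?_ h)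
      nlinarith
    | succ s hs ih =>
      intro hsr
      have hs1 : (1 : ℝ) ≤ s := by exact_mod_cast (by omega : 1 ≤ s)
      have hsr' : (s : ℝ) ≤ r := by exact_mod_cast (by omega : s ≤ r)
      refine le_of_mul_le_mul_left (a := (r + 1 : ℝ)) ?_ (by positivity)
      calc (r + 1 : ℝ) * (δ * n) ^ (s + 1) = (δ * n) ^ s * ((r + 1) * (δ * n)) := by ring
        _ ≤ (δ * n) ^ s * ((r + 1) * (γ / (r + 1) * n)) := by
            gcongr
            exact min_le_right _ _
        _ = (δ * n) ^ s * (n * (1 * γ)) := by field_simp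
        _ ≤ (δ * n) ^ s * (n * (s * γ)) := by gcongr
        _ ≤ (δ * n) ^ s * (n * (1 - s * θ)) := by
            gcongr
            exact hθs s (by omega)
        _ ≤ #(G.cliqueFinset s) * (n * (1 - s * θ)) := by
            have h0 : 0 ≤ 1 - s * θ := le_trans (by positivity) (hθs s (by omega))
            gcongr
            exact ih (by omega)
        _ ≤ (s + 1) * #(G.cliqueFinset (s + 1)) := (hrich s (by omega) (by omega)).2
        _ ≤ (r + 1) * #(G.cliqueFinset (s + 1)) := by gcongr
  rw [← mul_pow]
  exact hfinal (r + 1) (by omega) le_rfl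

/-! ### Blow-ups of logarithmic size -/

/-- Pigeonhole form of the Kővári–Sós–Turán argument: if each of `b` points is related to at least
`a` elements of `V`, then `m` of the points are all related to `m` common elements. -/
lemma exists_embedding_forall_rel {V : Type*} [Fintype V] {a b m : ℕ} (hb : 0 < b)
    (R : Fin b → V → Prop) [∀ j, DecidablePred (R j)] (hR : ∀ j, a ≤ #{w | R j w})
    (h : Fintype.card V * m + b * (2 ^ b * m) ≤ b * a) :
    ∃ (e : Fin m ↪ Fin b) (w : Fin m ↪ V), ∀ i j, R (e i) (w j) := by
  classical
  let J : V → Finset (Fin b) := fun w => {j | R j w}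
  let W : Finset V := {w | m ≤ #(J w)}
  have hsum : b * a ≤ ∑ w, #(J w) := by
    calc b * a = ∑ _j : Fin b, a := by simp
      _ ≤ ∑ j : Fin b, #{w | R j w} := sum_le_sum fun j _ => hR j
      _ = ∑ w, #(J w) := by
        simp_rw [J, card_eq_sum_ones, sum_filter]
        exact sum_comm
  have hle : ∑ w, #(J w) ≤ Fintype.card V * m + b * #W := by
    calc ∑ w, #(J w) ≤ ∑ w, (m + if w ∈ W then b else 0) := by
          refine sum_le_sum fun w _ => ?_
          split_ifs with hw
          · exact (card_le_univ _).trans (by simp)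
          · simp only [W, mem_filter, mem_univ, true_and, not_le] at hw
            omega
      _ = _ := by
          rw [sum_add_distrib, ← sum_filter]
          simp [mul_comm]
  have hW : 2 ^ b * m ≤ #W := by
    refine Nat.le_of_mul_le_mul_left ?_ hb
    omega
  obtain ⟨S, -, hS⟩ := exists_le_card_fiber_of_mul_le_card_of_maps_to (s := W)
    (t := (univ : Finset (Finset (Fin b)))) (f := J) (n := m) (fun _ _ => mem_univ _)
    univ_nonempty (by simpa using hW)
  rcases Nat.eq_zero_or_pos m with rfl | hm
  · exact ⟨⟨Fin.elim0, fun i => i.elim0⟩, ⟨Fin.elim0, fun i => i.elim0⟩, fun i => i.elim0⟩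
  have hSm : m ≤ #S := by
    obtain ⟨w, hw⟩ := card_pos.1 (hm.trans_le hS)
    simp only [W, mem_filter, mem_univ, true_and] at hw
    rw [← hw.2]
    exact hw.1
  obtain ⟨e⟩ : Nonempty (Fin m ↪ S) := Function.Embedding.nonempty_of_card_le (by simpa using hSm)
  obtain ⟨w⟩ : Nonempty (Fin m ↪ ({x ∈ W | J x = S} : Finset V)) :=
    Function.Embedding.nonempty_of_card_le
      (by rw [Fintype.card_fin, Fintype.card_coe]; exact hS)
  refine ⟨e.trans (Function.Embedding.subtype _), w.trans (Function.Embedding.subtype _), ?_⟩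
  intro i j
  have hw := (mem_filter.1 (w j).2).2
  have he : (e i : Fin b) ∈ J (w j) := by
    rw [hw]
    exact (e i).2
  simpa [J] using he

/-- Averaging over the last `k` coordinates: a dense set of `(k + 1)`-tuples contains many
extensions of each of a dense set of `k`-tuples. -/
lemma half_mul_pow_le_card_filter_cons {n k : ℕ} (hn : 0 < n) {c : ℝ} (hc : 0 ≤ c)
    (H : Finset (Fin (k + 1) → Fin n)) (hH : c * n ^ (k + 1) ≤ #H) :
    c / 2 * n ^ k ≤ #{f : Fin k → Fin n |
      c / 2 * n ≤ #{w | (Fin.cons w f : Fin (k + 1) → Fin n) ∈ H}} := by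
  classical
  set d : (Fin k → Fin n) → ℕ := fun f => #{w | (Fin.cons w f : Fin (k + 1) → Fin n) ∈ H}
  set H' : Finset (Fin k → Fin n) := {f | c / 2 * n ≤ d f}
  have hcard : #H = ∑ f, d f := by
    rw [card_eq_sum_card_fiberwise (f := Fin.tail) (t := univ) (fun _ _ => mem_coe.2 (mem_univ _))]
    refine sum_congr rfl fun f _ => ?_
    refine card_nbij' (fun g => g 0) (fun w => Fin.cons w f) ?_ ?_ ?_ ?_
    · intro g hg
      obtain ⟨hg, rfl⟩ := by simpa using hg
      simpa using hg
    · intro w hw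
      simpa using hw
    · intro g hg
      obtain ⟨hg, rfl⟩ := by simpa using hg
      simp
    · intro w _
      simp
  have hle : (∑ f, (d f : ℝ)) ≤ ∑ f, (c / 2 * n + if f ∈ H' then (n : ℝ) else 0) := by
    refine sum_le_sum fun f _ => ?_
    have hd : (d f : ℝ) ≤ n := by
      exact_mod_cast (card_le_univ _).trans (by simp)
    split_ifs with hf
    · have : 0 ≤ c / 2 * n := by positivity
      linarith
    · simp only [H', mem_filter, mem_univ, true_and, not_le] at hf
      linarith
  rw [sum_add_distrib, ← sum_filter] at hle
  have hn' : (0 : ℝ) < n := by exact_mod_cast hn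
  rw [hcard] at hH
  push_cast at hH
  simp at hle
  refine le_of_mul_le_mul_right ?_ hn'
  rw [pow_succ] at hH
  linarith

/-- A set `H` of at least `c n ^ k` ordered `k`-cliques of a graph on `n` vertices yields a complete
`k`-partite graph with parts of size `⌈C log n⌉`. The `j`-th points of the parts moreover form a
member of `H` for every `j`. Applying this to the set of `k`-cliques with many extensions gives
`k`-cliques that all have many extensions, which is what the induction on `k` needs. -/
theorem exists_multipartite_of_dense_cliques (k : ℕ) : ∀ c : ℝ, 0 < c → c ≤ 1 →
    ∃ C : ℝ, 0 < C ∧ C ≤ 1 / 2 ∧ ∃ N : ℕ, ∀ n : ℕ, N ≤ n → ∀ (G : SimpleGraph (Fin n))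
      (H : Finset (Fin k → Fin n)), (∀ f ∈ H, Pairwise fun i j => G.Adj (f i) (f j)) →
      c * n ^ k ≤ #H →
      ∃ x : Fin ⌈C * Real.log n⌉₊ → Fin k → Fin n, (∀ j, x j ∈ H) ∧
        (∀ i, Function.Injective fun j => x j i) ∧
        ∀ i i', i ≠ i' → ∀ j j', G.Adj (x j i) (x j' i') := by
  induction k with
  | zero =>
    intro c hc hc1
    refine ⟨1 / 2, by norm_num, le_rfl, 0, fun n _ G H _ hcard => ?_⟩
    have hpos : 0 < #H := by
      have : (0 : ℝ) < #H := by simp at hcard; linarith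
      exact_mod_cast this
    obtain ⟨f, hf⟩ := card_pos.1 hpos
    exact ⟨fun _ => f, fun _ => hf, fun i => i.elim0, fun i => i.elim0⟩
  | succ k ih =>
    intro c hc hc1
    obtain ⟨C, hC, hC2, N, hN⟩ := ih (c / 2) (by positivity) (by linarith)
    have hlog : ∀ᶠ n : ℕ in Filter.atTop, 192 / c + 8 / (c * C) + 1 ≤ Real.log n :=
      (Real.tendsto_log_atTop.comp tendsto_natCast_atTop_atTop).eventually_ge_atTop _
    obtain ⟨N', hN'⟩ := Filter.eventually_atTop.1 hlog
    -- About a `c / 4` fraction of the `b` tuples survives; the further factor `2` and the term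
    -- `8 / (c * C)` absorb the rounding, and `192 / c` makes `log n` negligible against `c √n`.
    refine ⟨c * C / 8, by positivity, by nlinarith, max N N', fun n hn G H hadj hcard => ?_⟩
    have hL := hN' n (le_of_max_le_right hn)
    set L := Real.log n with hLdef
    have hp1 : 0 < 192 / c := by positivity
    have hp2 : 0 < 8 / (c * C) := by positivity
    have hn0 : 0 < n := by
      rcases Nat.eq_zero_or_pos n with rfl | h
      · simp [hLdef] at hL; linarith
      · exact h
    have hn' : (0 : ℝ) < n := by exact_mod_cast hn0
    set b := ⌈C * L⌉₊
    set m := ⌈c * C / 8 * L⌉₊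
    obtain ⟨x, hxH, hinj, hx⟩ := hN n (le_of_max_le_left hn) G _ (fun f hf => by
      simp only [mem_filter, mem_univ, true_and] at hf
      have hpos : 0 < #{w | (Fin.cons w f : Fin (k + 1) → Fin n) ∈ H} := by
        have : 0 < c / 2 * n := by positivity
        exact_mod_cast this.trans_le hf
      obtain ⟨w, hw⟩ := card_pos.1 hpos
      simp only [mem_filter, mem_univ, true_and] at hw
      intro i j hij
      simpa using hadj _ hw ((Fin.succ_injective k).ne hij))
      (half_mul_pow_le_card_filter_cons hn0 hc.le H hcard)
    have hL1 : 1 ≤ L := by linarith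
    have hcL : 192 ≤ c * L := by
      have : 192 / c ≤ L := by linarith
      rwa [div_le_iff₀' hc] at this
    have hcCL : 8 ≤ c * C * L := by
      have : 8 / (c * C) ≤ L := by linarith
      rwa [div_le_iff₀' (by positivity)] at this
    have hb1 : C * L ≤ b := Nat.le_ceil _
    have hb2 : (b : ℝ) ≤ C * L + 1 := (Nat.ceil_lt_add_one (by positivity)).le
    have hb2' : (b : ℝ) ≤ L / 2 + 1 := by nlinarith
    have hb : 0 < b := Nat.ceil_pos.2 (by positivity)
    have hm1 : (m : ℝ) ≤ c * b / 4 := by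
      have : (m : ℝ) ≤ c * C / 8 * L + 1 := (Nat.ceil_lt_add_one (by positivity)).le
      have : c * (C * L) ≤ c * b := by gcongr
      nlinarith
    have hm2 : (m : ℝ) ≤ L + 1 := by
      have : c * b ≤ 1 * b := by gcongr
      linarith
    have hexp : (2 : ℝ) ^ b * m ≤ c * n / 4 := by
      -- Here `2 ^ b ≤ exp b ≤ 3 √n`, while `m = O(log n)`.
      have h1 : (2 : ℝ) ^ b ≤ Real.exp (L / 2) * 3 := by
        calc (2 : ℝ) ^ b ≤ Real.exp 1 ^ b := by
              gcongr
              linarith [Real.add_one_le_exp 1]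
          _ = Real.exp b := by rw [← Real.exp_nat_mul, mul_one]
          _ ≤ Real.exp (L / 2 + 1) := Real.exp_le_exp.2 hb2'
          _ = Real.exp (L / 2) * Real.exp 1 := Real.exp_add _ _
          _ ≤ Real.exp (L / 2) * 3 := by
              gcongr
              exact Real.exp_one_lt_three.le
      have h2 : (n : ℝ) = Real.exp (L / 2) * Real.exp (L / 2) := by
        rw [← Real.exp_add, add_halves, Real.exp_log hn']
      have h3 := Real.quadratic_le_exp_of_nonneg (x := L / 2) (by positivity)
      have h4 : 3 * (L + 1) ≤ c / 4 * Real.exp (L / 2) := by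
        have : c / 4 * (L ^ 2 / 8) ≤ c / 4 * Real.exp (L / 2) := by
          gcongr
          nlinarith
        nlinarith
      calc (2 : ℝ) ^ b * m ≤ Real.exp (L / 2) * 3 * (L + 1) := by gcongr
        _ = Real.exp (L / 2) * (3 * (L + 1)) := by ring
        _ ≤ Real.exp (L / 2) * (c / 4 * Real.exp (L / 2)) := by gcongr
        _ = c * n / 4 := by rw [h2]; ring
    obtain ⟨e, w, hew⟩ := exists_embedding_forall_rel (V := Fin n) (a := ⌈c / 2 * n⌉₊) (m := m) hb
      (fun j v => (Fin.cons v (x j) : Fin (k + 1) → Fin n) ∈ H)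
      (fun j => by
        have := hxH j
        simp only [mem_filter, mem_univ, true_and] at this
        exact Nat.ceil_le.2 this)
      (by
        have h1 : (n * m + b * (2 ^ b * m) : ℝ) ≤ b * ⌈c / 2 * n⌉₊ := by
          calc (n * m + b * (2 ^ b * m) : ℝ) ≤ n * (c * b / 4) + b * (c * n / 4) := by gcongr
            _ = b * (c / 2 * n) := by ring
            _ ≤ _ := by gcongr; exact Nat.le_ceil _
        rw [Fintype.card_fin]
        exact_mod_cast h1)
    refine ⟨fun j => Fin.cons (w j) (x (e j)), fun j => hew j j, ?_, ?_⟩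
    · intro i
      refine Fin.cases ?_ (fun i => ?_) i
      · simpa using w.injective
      · simpa [Function.comp_def] using (hinj i).comp e.injective
    · have hcross : ∀ i j j', G.Adj (w j) (x (e j') i) := fun i j j' => by
        simpa using hadj _ (hew j' j) (Fin.succ_ne_zero i).symm
      intro i i' hii j j'
      induction i using Fin.cases with
      | zero =>
        induction i' using Fin.cases with
        | zero => exact absurd rfl hii
        | succ i' => simpa using hcross i' j j'
      | succ i =>
        induction i' using Fin.cases with
        | zero => simpa using (hcross i j' j).symm
        | succ i' => simpa using hx i i' (fun h => hii (h ▸ rfl)) (e j) (e j')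

lemma card_cliqueFinset_le_card_tuples {V : Type*} [Fintype V] [LinearOrder V]
    (G : SimpleGraph V) [DecidableRel G.Adj] (k : ℕ) :
    #(G.cliqueFinset k) ≤
      #{f : Fin k → V | ∀ i j, i ≠ j → G.Adj (f i) (f j)} := by
  refine card_le_card_of_surjOn (fun f => univ.image f) fun A hA => ?_
  rw [mem_coe, mem_cliqueFinset_iff] at hA
  refine ⟨A.orderEmbOfFin hA.card_eq, ?_, A.image_orderEmbOfFin_univ hA.card_eq⟩
  refine mem_coe.2 (mem_filter.2 ⟨mem_univ _, fun i j hij => ?_⟩)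
  exact hA.isClique (A.orderEmbOfFin_mem _ i) (A.orderEmbOfFin_mem _ j)
    ((A.orderEmbOfFin hA.card_eq).injective.ne hij)

/-- Nikiforov's theorem: a graph with a positive proportion of all possible `k`-cliques contains
a complete `k`-partite graph with parts of logarithmic size. -/
theorem exists_completeEquipartiteGraph_isContained (k : ℕ) {c : ℝ} (hc : 0 < c) (hc1 : c ≤ 1) :
    ∃ C : ℝ, 0 < C ∧ ∃ N : ℕ, ∀ n, N ≤ n → ∀ (G : SimpleGraph (Fin n)) [DecidableRel G.Adj],
      c * n ^ k ≤ #(G.cliqueFinset k) →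
        ∃ b : ℕ, C * Real.log n ≤ b ∧ (completeEquipartiteGraph k b).IsContained G := by
  obtain ⟨C, hC, -, N, hN⟩ := exists_multipartite_of_dense_cliques k c hc hc1
  refine ⟨C, hC, N, fun n hn G _ h => ⟨⌈C * Real.log n⌉₊, Nat.le_ceil _, ?_⟩⟩
  obtain ⟨x, -, hinj, hx⟩ := hN n hn G {f | ∀ i j, i ≠ j → G.Adj (f i) (f j)}
    (fun f hf i j hij => (mem_filter.1 hf).2 i j hij)
    (h.trans (by exact_mod_cast G.card_cliqueFinset_le_card_tuples k))
  refine ⟨⟨⟨fun p => x p.2 p.1, fun {p q} hpq => ?_⟩, ?_⟩⟩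
  · exact hx _ _ (completeEquipartiteGraph_adj.1 hpq) _ _
  · rintro ⟨i, j⟩ ⟨i', j'⟩ hxx
    have hxx : x j i = x j' i' := hxx
    obtain rfl : i = i' := by
      by_contra hii
      exact (hx i i' hii j j').ne hxx
    rw [hinj i hxx]

end SimpleGraph

theorem mainTheorem5 (r : ℕ) (ε : ℝ) (hε : 0 < ε) :
    ∃ C : ℝ, 0 < C ∧ ∃ n₀ : ℕ, ∀ t : ℕ, 1 ≤ t → t ≤ r → ∀ n : ℕ, n₀ ≤ n →
      ∀ (G : SimpleGraph (Fin n)) [DecidableRel G.Adj],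
        (1 + ε) * (((SimpleGraph.turanGraph n r).cliqueFinset t).card : ℝ) ≤
            ((G.cliqueFinset t).card : ℝ) →
          ∃ b : ℕ, C * Real.log (n : ℝ) ≤ (b : ℝ) ∧
            (SimpleGraph.completeEquipartiteGraph (r + 1) b).IsContained G := by
  rcases Nat.eq_zero_or_pos r with rfl | hr
  · exact ⟨1, one_pos, 0, fun t h1 h2 => by omega⟩
  obtain ⟨c, hc, hc1, N, hN⟩ := SimpleGraph.exists_mul_pow_le_card_cliqueFinset hr hε
  obtain ⟨C, hC, N', hN'⟩ :=
    SimpleGraph.exists_completeEquipartiteGraph_isContained (r + 1) hc hc1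
  exact ⟨C, hC, max N N', fun t _ htr n hn G _ h =>
    hN' n (le_of_max_le_right hn) G (hN t htr n (le_of_max_le_left hn) G h)⟩
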